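/- For sequences $p,q\in\mathbb N^{\mathbb N}$ let $\langle p,q\rangle=(p(0),q(0),p(1),q(1),\dots)$; fix a standard bijective coding of pairs of natural numbers. A represented space $(X,\delta_X)$ is a set $X$ with a surjective partial map $\delta_X:\subseteq\mathbb N^{\mathbb N}\to X$; if $\delta_X(p)=x$, then $p$ is a name of $x$. A problem $f:\subseteq X\rightrightarrows Y$ is a partial multi-valued map between represented spaces with domain $\{x: f(x)\neq\emptyset\}$. A partial function $F:\subseteq\mathbb N^{\mathbb N}\to\mathbb N^{\mathbb N}$ realizes $f$ if for every name $p$ of a point $x\in\operatorname{dom}(f)$ the value $F(p)$ is defined and is a name of some $y\in f(x)$. For problems $f,g$, write $f\le_{\mathrm W}g$ if there are computable $H,K:\subseteq\mathbb N^{\mathbb N}\to\mathbb N^{\mathbb N}$ such that for every realizer $G$ of $g$ the partial function $p\mapsto H\langle p,GK(p)\rangle$ realizes $f$, and write $f<_{\mathrm W}g$ if $f\le_{\mathrm W}g$ and $g\not\le_{\mathrm W}f$. The completion of $(X,\delta_X)$ is $\overline X=X\cup\{\bot\}$ with $\bot\notin X$, in which $p\in\mathbb N^{\mathbb N}$ names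 $x\in X$ if deleting all zeros from $p$ and decreasing all other digits by $1$ gives an infinite sequence that is a name of $x$ in $X$, and every other $p$ names $\bot$. The completion of $f:\subseteq X\rightrightarrows Y$ is the problem $\overline f:\overline X\rightrightarrows\overline Y$ with $\overline f(x)=f(x)$ if $x\in\operatorname{dom}(f)$ and $\overline f(x)=\overline Y$ otherwise. Let $\alpha(\langle\langle a,b\rangle,c\rangle)=\frac{a-b}{c+1}$ be the standard enumeration of $\mathbb Q$. Represent $\mathbb R$ by its Cauchy representation: $p$ names $\lim_n\alpha(p(n))$ if $|\alpha(p(i))-\alpha(p(j))|\le 2^{-i}$ for all $i\le j$. Let $\mathcal A_-(\mathbb R)$ be the set of closed subsets of $\mathbb R$, where $p$ names $\mathbb R\setminus\bigcup_{n}B_{p(n)}$ and $B_{\langle n,\langle i,k\rangle\rangle}$ is the open ball with centre $\alpha(n)$ and radius $\frac{i}{k+1}$. Let $\mathsf C_{\mathbb R}:\subseteq\mathcal A_-(\mathbb R)\rightrightarrows\mathbb R$, $A\mapsto A$, be defined on the non-empty closed sets, and let $\mathsf{PC}_{\mathbb R}$ be its restriction to the closed sets of positive Lebesgue measure. Proposition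 (Choice on Euclidean space). $\mathsf C_{\mathbb R}<_{\mathrm W}\overline{\mathsf C_{\mathbb R}}$ and $\mathsf{PC}_{\mathbb R}<_{\mathrm W}\overline{\mathsf{PC}_{\mathbb R}}$. -/

import Mathlib

namespace Weihrauch

/-- Baire space, the set of infinite sequences of natural numbers. -/
abbrev Baire : Type := ℕ → ℕ

/-- The finite word `p 0, …, p (n - 1)`. -/
def pre (p : Baire) (n : ℕ) : List ℕ := (List.range n).map p

/-- A partial function on Baire space is computable if some computable word function, monotone
for the prefix order, approximates it: for `p` in the domain, the words `φ (pre p n)` are finite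
prefixes of the value `F p` of unbounded length (by monotonicity it suffices that each prefix of
`F p` is eventually produced). This is computability by a machine with a one-way output tape that
reads longer and longer prefixes of its input. As usual, nothing is required of `φ` outside of
the domain. -/
def IsComputable (F : Baire →. Baire) : Prop :=
  ∃ φ : List ℕ → List ℕ, Computable φ ∧ (∀ u v : List ℕ, u <+: v → φ u <+: φ v) ∧
    ∀ p : Baire, ∀ q ∈ F p, ∀ k : ℕ, ∃ n : ℕ, pre q k <+: φ (pre p n)

/-- The pairing `⟨p, q⟩ = p 0, q 0, p 1, q 1, …`. -/
def pairing (p q : Baire) : Baire := fun n => if n % 2 = 0 then p (n / 2) else q (n / 2)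

/-- A represented space: a set with a surjective partial map from Baire space onto it. -/
structure RepresentedSpace where
  carrier : Type
  rep : Baire →. carrier
  surj : ∀ x : carrier, ∃ p : Baire, x ∈ rep p

instance : CoeSort RepresentedSpace Type := ⟨RepresentedSpace.carrier⟩

/-- A problem: a partial multi-valued map between represented spaces, given by its sets of
values. It is defined exactly at the points with a non-empty set of values. -/
def Problem (X Y : RepresentedSpace) : Type := X → Set Y

/-- The domain of a problem. -/
def Problem.dom {X Y : RepresentedSpace} (f : Problem X Y) : Set X := {x | (f x).Nonempty}

/-- `F` realizes `f`: it maps each name of each `x` in the domain of `f` to a name of some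
element of `f x` (and is, in particular, defined there). -/
def Realizes {X Y : RepresentedSpace} (F : Baire →. Baire) (f : Problem X Y) : Prop :=
  ∀ p : Baire, ∀ x ∈ X.rep p, x ∈ f.dom → ∃ q ∈ F p, ∃ y ∈ Y.rep q, y ∈ f x

/-- The partial function `H ∘ ⟨id, G ∘ K⟩`, with its natural domain. -/
def reduct (H K G : Baire →. Baire) : Baire →. Baire :=
  fun p => (K p).bind fun k => (G k).bind fun r => H (pairing p r)

/-- Weihrauch reducibility. -/
def Reducible {X Y U V : RepresentedSpace} (f : Problem X Y) (g : Problem U V) : Prop :=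
  ∃ H K : Baire →. Baire, IsComputable H ∧ IsComputable K ∧
    ∀ G : Baire →. Baire, Realizes G g → Realizes (reduct H K G) f

/-- Strict Weihrauch reducibility. -/
def StrictlyReducible {X Y U V : RepresentedSpace} (f : Problem X Y) (g : Problem U V) : Prop :=
  Reducible f g ∧ ¬ Reducible g f

/-- The partial map `p ↦ p - 1`: delete the zeros of `p` and decrease the remaining digits by
one. It is defined if the result is an infinite sequence. -/
noncomputable def decr : Baire →. Baire := fun p =>
  { Dom := {n | p n ≠ 0}.Infinite
    get := fun _ n => p (Nat.nth (fun m => p m ≠ 0) n) - 1 }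

open Classical in
/-- The completion of a represented space: a point `⊥` (here `none`) is added; a sequence `p`
names `x` if `p - 1` is an infinite sequence that names `x` in the given space, and every other
sequence names `⊥`. -/
noncomputable def RepresentedSpace.completion (X : RepresentedSpace) : RepresentedSpace where
  carrier := Option X
  rep := fun p => Part.some ((decr p).bind X.rep).toOption
  surj := by
    intro x
    cases x with
    | none =>
      refine ⟨fun _ => 0, ?_⟩
      have h : ¬ ((decr fun _ => 0).bind X.rep).Dom := by
        rintro ⟨h, -⟩
        exact h (by simp)
      simp [Part.toOption, h]
    | some x =>
      obtain ⟨p, hp⟩ := X.surj x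
      refine ⟨fun n => p n + 1, ?_⟩
      have hd : p ∈ decr fun n => p n + 1 := by
        refine ⟨?_, ?_⟩
        · change {n : ℕ | p n + 1 ≠ 0}.Infinite
          simpa using Set.infinite_univ
        · funext n
          simp [decr, Nat.nth_true]
      have h : x ∈ (decr fun n => p n + 1).bind X.rep := Part.mem_bind hd hp
      rw [Part.mem_some_iff, eq_comm]
      exact Part.mem_toOption.2 h

/-- The completion of a problem: the same values on the domain of `f`, and all points of the
completed target space elsewhere. -/
def Problem.completion {X Y : RepresentedSpace} (f : Problem X Y) :
    Problem X.completion Y.completion :=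
  fun x => {y | ∀ a : X, x = some a → a ∈ f.dom → ∃ b ∈ f a, y = some b}

section Metric

variable {X : Type} [MetricSpace X]

/-- The space `X` with the Cauchy representation given by a dense sequence `α`: the names of `x`
are the `p` for which `α (p 0), α (p 1), …` converges to `x`, with
`d (α (p i)) (α (p j)) ≤ 2⁻ⁱ` whenever `i ≤ j`. -/
noncomputable def cauchySpace (α : ℕ → X) (hα : DenseRange α) : RepresentedSpace where
  carrier := X
  rep := fun p =>
    { Dom := (∀ i j : ℕ, i ≤ j → dist (α (p i)) (α (p j)) ≤ (1 / 2 : ℝ) ^ i) ∧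
        ∃ x : X, Filter.Tendsto (fun n => α (p n)) Filter.atTop (nhds x)
      get := fun h => h.2.choose }
  surj := by
    intro x
    have h : ∀ n : ℕ, ∃ m : ℕ, dist x (α m) < (1 / 2 : ℝ) ^ (n + 1) := fun n =>
      hα.exists_dist_lt x (by positivity)
    choose p hp using h
    have hlim : Filter.Tendsto (fun n => α (p n)) Filter.atTop (nhds x) := by
      rw [tendsto_iff_dist_tendsto_zero]
      refine squeeze_zero (fun _ => dist_nonneg) (fun n => ?_)
        ((tendsto_pow_atTop_nhds_zero_of_lt_one (by norm_num : (0 : ℝ) ≤ 1 / 2)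
          (by norm_num)).comp (Filter.tendsto_add_atTop_nat 1))
      rw [dist_comm]
      exact (hp n).le
    refine ⟨p, ⟨?_, x, hlim⟩, ?_⟩
    · intro i j hij
      have h1 := dist_triangle_left (α (p i)) (α (p j)) x
      have h2 : (1 / 2 : ℝ) ^ (j + 1) ≤ (1 / 2 : ℝ) ^ (i + 1) :=
        pow_le_pow_of_le_one (by norm_num) (by norm_num) (by omega)
      have h3 : (1 / 2 : ℝ) ^ (i + 1) = (1 / 2 : ℝ) ^ i / 2 := by ring
      linarith [hp i, hp j]
    · exact tendsto_nhds_unique (Exists.choose_spec (p := fun y : X =>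
        Filter.Tendsto (fun n => α (p n)) Filter.atTop (nhds y)) ⟨x, hlim⟩) hlim

/-- The basic open ball with code `⟨n, ⟨i, k⟩⟩`, of centre `α n` and radius `i / (k + 1)`. -/
def basicBall (α : ℕ → X) (c : ℕ) : Set X :=
  Metric.ball (α c.unpair.1) ((c.unpair.2.unpair.1 : ℝ) / ((c.unpair.2.unpair.2 : ℝ) + 1))

theorem isOpen_basicBall (α : ℕ → X) (c : ℕ) : IsOpen (basicBall α c) := Metric.isOpen_ball

/-- The closed subsets of `X` with negative information: `p` names the complement of the union
of the basic open balls with codes `p 0, p 1, …`. -/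
def closedSpace (α : ℕ → X) (hα : DenseRange α) : RepresentedSpace where
  carrier := TopologicalSpace.Closeds X
  rep := fun p => Part.some
    ⟨(⋃ n, basicBall α (p n))ᶜ, (isOpen_iUnion fun n => isOpen_basicBall α (p n)).isClosed_compl⟩
  surj := by
    classical
    intro A
    have h0 : basicBall α (Nat.pair 0 (Nat.pair 0 0)) = ∅ := by simp [basicBall]
    refine ⟨fun c => if basicBall α c ⊆ (A : Set X)ᶜ then c else Nat.pair 0 (Nat.pair 0 0), ?_⟩
    rw [Part.mem_some_iff]
    refine TopologicalSpace.Closeds.ext ?_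
    change (A : Set X) = (⋃ n, basicBall α _)ᶜ
    rw [eq_comm, compl_eq_comm]
    refine Set.Subset.antisymm ?_ (Set.iUnion_subset fun c => ?_)
    · intro x hx
      obtain ⟨ε, hε, hball⟩ := Metric.isOpen_iff.1 A.isClosed.isOpen_compl x hx
      obtain ⟨k, hk⟩ := exists_nat_one_div_lt (half_pos hε)
      obtain ⟨m, hm⟩ := hα.exists_dist_lt x (Nat.one_div_pos_of_nat (α := ℝ) (n := k))
      have hb : basicBall α (Nat.pair m (Nat.pair 1 k)) = Metric.ball (α m) (1 / ((k : ℝ) + 1)) := by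
        simp [basicBall]
      refine Set.mem_iUnion.2 ⟨Nat.pair m (Nat.pair 1 k), ?_⟩
      rw [if_pos]
      · rw [hb]
        exact hm
      · rw [hb]
        intro y hy
        apply hball
        rw [Metric.mem_ball] at hy ⊢
        have := dist_triangle y (α m) x
        rw [dist_comm (α m) x] at this
        linarith
    · split_ifs with h
      · exact h
      · rw [h0]
        exact Set.empty_subset _

/-- Closed choice on `X`: given a non-empty closed set, find a point of it. -/
def choice (α : ℕ → X) (hα : DenseRange α) : Problem (closedSpace α hα) (cauchySpace α hα) :=
  fun (A : TopologicalSpace.Closeds X) => (A : Set X)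

/-- Positive choice on `X`: closed choice restricted to closed sets of positive measure. -/
def positiveChoice [MeasurableSpace X] (μ : MeasureTheory.Measure X) (α : ℕ → X)
    (hα : DenseRange α) : Problem (closedSpace α hα) (cauchySpace α hα) :=
  fun (A : TopologicalSpace.Closeds X) => {x : X | x ∈ A ∧ 0 < μ (A : Set X)}

end Metric

/-- The standard enumeration of the rational numbers as points of the real line:
`⟨⟨a, b⟩, c⟩ ↦ (a - b) / (c + 1)`. -/
noncomputable def ratSeq (n : ℕ) : ℝ :=
  ((n.unpair.1.unpair.1 : ℝ) - (n.unpair.1.unpair.2 : ℝ)) / ((n.unpair.2 : ℝ) + 1)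

theorem denseRange_ratSeq : DenseRange ratSeq := by
  refine Rat.denseRange_cast.mono ?_
  rintro _ ⟨q, rfl⟩
  refine ⟨Nat.pair (Nat.pair q.num.toNat (-q.num).toNat) (q.den - 1), ?_⟩
  have h1 : ((q.num.toNat : ℝ) - ((-q.num).toNat : ℝ)) = (q.num : ℝ) := by
    have h : (q.num.toNat : ℤ) - ((-q.num).toNat : ℤ) = q.num := Int.toNat_sub_toNat_neg q.num
    exact_mod_cast congrArg (Int.cast : ℤ → ℝ) h
  have h2 : ((q.den - 1 : ℕ) : ℝ) + 1 = (q.den : ℝ) := by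
    have := q.den_pos
    exact_mod_cast (by omega : q.den - 1 + 1 = q.den)
  simp only [ratSeq, Nat.unpair_pair, h1, h2]
  exact (Rat.cast_def q).symm

/-- Closed choice on the real line. -/
noncomputable def choiceReal :
    Problem (closedSpace ratSeq denseRange_ratSeq) (cauchySpace ratSeq denseRange_ratSeq) :=
  choice ratSeq denseRange_ratSeq

/-- Closed choice on the real line for closed sets of positive Lebesgue measure. -/
noncomputable def positiveChoiceReal :
    Problem (closedSpace ratSeq denseRange_ratSeq) (cauchySpace ratSeq denseRange_ratSeq) :=
  positiveChoice MeasureTheory.volume ratSeq denseRange_ratSeq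

end Weihrauch

namespace Weihrauch

open Filter Topology

/-! A problem reduces to its completion by adding one to every digit of the instance and undoing
this on the answer. Conversely, suppose the completion reduces to choice via `H` and `K`. Every
sequence names an instance of the completion, so `K` is total and each `p` yields a non-empty closed
set `A p`. By Baire category, on some cylinder all `A p` meet one fixed compact ball (properness).
Points of that ball have names in a compact set. If `p₁` in the cylinder names a closed set with
bounded complement, then `H` must start writing a genuine point on every such name of a point of `A
p₁`; by continuity and compactness its answers stay in a bounded region for all `p` near `p₁`
(`exists_forall_dist_le`). But a finite prefix of `p₁` can still be continued so as to remove that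
whole region (`exists_extension`), a contradiction. Only continuity of `H` and `K` is used in this
direction. -/

/-! ### Prefixes and continuity -/

theorem pre_prefix_pre (p : Baire) {m n : ℕ} (h : m ≤ n) : pre p m <+: pre p n := by
  obtain ⟨d, rfl⟩ := Nat.exists_eq_add_of_le h
  simp [pre, List.range_add]

theorem pre_eq_pre_iff {p q : Baire} {n : ℕ} : pre p n = pre q n ↔ ∀ i < n, p i = q i := by
  simp [pre]

theorem eventually_pre_eq (p : Baire) (n : ℕ) : ∀ᶠ p' in 𝓝 p, pre p' n = pre p n := by
  filter_upwards [(PiNat.isOpen_cylinder (fun _ => ℕ) p n).mem_nhds (PiNat.self_mem_cylinder p n)]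
    with p' hp'
  exact pre_eq_pre_iff.2 hp'

/-- Computable partial functions are continuous. -/
theorem IsComputable.eventually_apply_eq {F : Baire →. Baire} (hF : IsComputable F) {p q : Baire}
    (hq : q ∈ F p) (i : ℕ) : ∀ᶠ p' in 𝓝 p, ∀ q' ∈ F p', q' i = q i := by
  obtain ⟨φ, -, hmono, hφ⟩ := hF
  obtain ⟨n, hn⟩ := hφ p q hq (i + 1)
  filter_upwards [eventually_pre_eq p n] with p' hp' q' hq'
  obtain ⟨n', hn'⟩ := hφ p' q' hq' (i + 1)
  rw [← hp'] at hn
  have h1 := hn.trans (hmono _ _ (pre_prefix_pre p' (le_max_left n n')))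
  have h2 := hn'.trans (hmono _ _ (pre_prefix_pre p' (le_max_right n n')))
  have h3 : pre q' (i + 1) = pre q (i + 1) :=
    (List.prefix_of_prefix_length_le h2 h1 (by simp [pre])).eq_of_length (by simp [pre])
  exact pre_eq_pre_iff.1 h3 i (Nat.lt_succ_self i)

/-! ### Names in completions -/

theorem mem_decr_iff {p q : Baire} :
    q ∈ decr p ↔ {n | p n ≠ 0}.Infinite ∧ ∀ n, q n = p (Nat.nth (fun m => p m ≠ 0) n) - 1 := by
  constructor
  · rintro ⟨h, rfl⟩
    exact ⟨h, fun _ => rfl⟩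
  · rintro ⟨h, hq⟩
    exact ⟨h, funext fun n => (hq n).symm⟩

theorem mem_decr_succ (p : Baire) : p ∈ decr fun n => p n + 1 := by
  refine mem_decr_iff.2 ⟨by simpa using Set.infinite_univ, fun n => ?_⟩
  simp [Nat.nth_true]

/-- The values of `p - 1` are the predecessors of the nonzero values of `p`. -/
theorem exists_apply_eq_iff_of_mem_decr {p q : Baire} (h : q ∈ decr p) (c : ℕ) :
    (∃ n, q n = c) ↔ ∃ n, p n = c + 1 := by
  classical
  obtain ⟨hinf, hq⟩ := mem_decr_iff.1 h
  constructor
  · rintro ⟨n, rfl⟩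
    have := Nat.nth_mem_of_infinite hinf n
    exact ⟨_, by rw [hq, Nat.sub_add_cancel (Nat.one_le_iff_ne_zero.2 this)]⟩
  · rintro ⟨n, hn⟩
    refine ⟨Nat.count (fun m => p m ≠ 0) n, ?_⟩
    rw [hq, Nat.nth_count (p := fun m => p m ≠ 0) (by omega), hn, Nat.add_sub_cancel]

theorem some_mem_completion_rep {X : RepresentedSpace} {p : Baire} {x : X} :
    some x ∈ X.completion.rep p ↔ ∃ q ∈ decr p, x ∈ X.rep q := by
  classical
  change some x ∈ Part.some ((decr p).bind X.rep).toOption ↔ _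
  rw [Part.mem_some_iff, eq_comm]
  exact Part.mem_toOption.trans Part.mem_bind_iff

theorem exists_mem_completion_rep (X : RepresentedSpace) (p : Baire) :
    ∃ x, x ∈ X.completion.rep p :=
  ⟨_, Part.mem_some _⟩

/-- With `exists_mem_completion_rep`, this forces the inner map of a reduction to be defined on all
of Baire space. -/
theorem mem_dom_completion {X Y : RepresentedSpace} (f : Problem X Y) (x : X.completion) :
    x ∈ f.completion.dom := by
  classical
  by_cases h : ∃ a ∈ f.dom, x = some a
  · obtain ⟨a, ⟨b, hb⟩, rfl⟩ := h
    refine ⟨some b, fun a' ha' _ => ⟨b, ?_, rfl⟩⟩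
    rwa [← Option.some_injective _ ha']
  · exact ⟨none, fun a ha hd => (h ⟨a, hd, ha⟩).elim⟩

/-! ### Reduction to the completion -/

/-- The word function that computes `⟨p, r⟩ ↦ r - 1`. -/
def decrOddWord (u : List ℕ) : List ℕ :=
  (List.range (u.length / 2)).filterMap fun i =>
    if u.getD (2 * i + 1) 0 = 0 then none else some (u.getD (2 * i + 1) 0 - 1)

theorem computable_decrOddWord : Computable decrOddWord := by
  apply Primrec.to_comp
  have h : Primrec₂ fun (u : List ℕ) (i : ℕ) => u.getD (2 * i + 1) 0 :=
    (Primrec.list_getD 0).comp Primrec.fst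
      (Primrec.succ.comp (Primrec.nat_mul.comp (Primrec.const 2) Primrec.snd))
  refine Primrec.listFilterMap
    (Primrec.list_range.comp (Primrec.nat_div.comp Primrec.list_length (Primrec.const 2))) ?_
  exact Primrec.ite (Primrec.eq.comp h (Primrec.const 0)) (Primrec.const none)
    (Primrec.option_some.comp (Primrec.pred.comp h))

theorem decrOddWord_mono {u v : List ℕ} (h : u <+: v) : decrOddWord u <+: decrOddWord v := by
  obtain ⟨w, rfl⟩ := h
  have hle : u.length / 2 ≤ (u ++ w).length / 2 := by
    rw [List.length_append]
    omega
  obtain ⟨d, hd⟩ := Nat.exists_eq_add_of_le hle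
  rw [decrOddWord, decrOddWord, hd, List.range_add, List.filterMap_append]
  convert List.prefix_append _ _ using 2
  refine List.filterMap_congr fun i hi => ?_
  rw [List.mem_range] at hi
  rw [List.getD_append _ _ _ _ (by omega)]

theorem filterMap_range_eq_map_nth (r : Baire) (N : ℕ) :
    ((List.range N).filterMap fun i => if r i = 0 then none else some (r i - 1)) =
      (List.range (Nat.count (fun m => r m ≠ 0) N)).map
        fun n => r (Nat.nth (fun m => r m ≠ 0) n) - 1 := by
  induction N with
  | zero => simp
  | succ N ih =>
    rw [List.range_succ, List.filterMap_append, ih, Nat.count_succ]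
    by_cases h : r N = 0
    · simp [h]
    · simp only [h, ne_eq, not_false_eq_true, if_true, List.range_succ, List.map_append]
      simp [h, Nat.nth_count (p := fun m => ¬ r m = 0) h]

theorem pairing_odd (p r : Baire) (n : ℕ) : pairing p r (2 * n + 1) = r n := by
  rw [pairing, if_neg (by omega)]
  congr 1
  omega

theorem isComputable_decr_odd : IsComputable fun s => decr fun n => s (2 * n + 1) := by
  refine ⟨decrOddWord, computable_decrOddWord, fun _ _ => decrOddWord_mono, fun s q hq k => ?_⟩
  obtain ⟨hinf, hq⟩ := mem_decr_iff.1 hq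
  set P : ℕ → Prop := fun m => s (2 * m + 1) ≠ 0
  -- The odd digits read so far contain exactly `k` nonzero ones; the factor 2 accounts for the
  -- interleaving.
  refine ⟨2 * Nat.nth P k, ?_⟩
  have h1 : decrOddWord (pre s (2 * Nat.nth P k)) = (List.range (Nat.nth P k)).filterMap
      fun i => if s (2 * i + 1) = 0 then none else some (s (2 * i + 1) - 1) := by
    rw [decrOddWord]
    have hl : (pre s (2 * Nat.nth P k)).length / 2 = Nat.nth P k := by simp [pre]
    rw [hl]
    refine List.filterMap_congr fun i hi => ?_
    rw [List.mem_range] at hi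
    have : (pre s (2 * Nat.nth P k)).getD (2 * i + 1) 0 = s (2 * i + 1) := by
      have : 2 * i + 1 < 2 * Nat.nth P k := by omega
      simp [pre, List.getD_eq_getElem?_getD, this]
    rw [this]
  rw [h1, filterMap_range_eq_map_nth (fun i => s (2 * i + 1)),
    Nat.count_nth_of_infinite (p := fun m => s (2 * m + 1) ≠ 0) hinf]
  rw [pre, List.map_congr_left fun n _ => hq n]

theorem isComputable_succ : IsComputable fun p => Part.some fun n => p n + 1 := by
  refine ⟨List.map Nat.succ, ?_, fun u v h => h.map _, fun p q hq k => ⟨k, ?_⟩⟩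
  · exact (Primrec.list_map Primrec.id (Primrec.succ.comp Primrec.snd).to₂).to_comp
  · rw [Part.mem_some_iff] at hq
    subst hq
    simp [pre, Function.comp_def]

/-- Every problem is reducible to its completion. -/
theorem reducible_completion {X Y : RepresentedSpace} (f : Problem X Y) :
    Reducible f f.completion := by
  refine ⟨_, _, isComputable_decr_odd, isComputable_succ, fun G hG p x hx hdom => ?_⟩
  have hx' : some x ∈ X.completion.rep fun n => p n + 1 :=
    some_mem_completion_rep.2 ⟨p, mem_decr_succ p, hx⟩
  obtain ⟨r, hr, y, hy, hyf⟩ := hG _ _ hx' (mem_dom_completion f _)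
  obtain ⟨b, hb, rfl⟩ := hyf x rfl hdom
  obtain ⟨q, hq, hbq⟩ := some_mem_completion_rep.1 hy
  refine ⟨q, ?_, b, hbq, hb⟩
  simp only [reduct, Part.bind_some, Part.mem_bind_iff]
  refine ⟨r, hr, ?_⟩
  simpa only [pairing_odd] using hq

/-! ### Pointwise form of reductions; topology of Baire space -/

/-- A reduction works pointwise: for a name `p` of an instance `x` of `g`, the map `K` yields a
name of an instance `a` of `f`, and every name `r` of every solution of `a` gives rise to a
solution of `x`. -/
theorem Reducible.exists_pointwise {X Y U V : RepresentedSpace} {g : Problem X Y}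
    {f : Problem U V} (h : Reducible g f) :
    ∃ H K : Baire →. Baire, IsComputable H ∧ IsComputable K ∧ ∀ p, ∀ x ∈ X.rep p, x ∈ g.dom →
      ∃ k ∈ K p, ∃ a ∈ U.rep k, a ∈ f.dom ∧ ∀ r, ∀ b ∈ V.rep r, b ∈ f a →
        ∃ t ∈ H (pairing p r), ∃ y ∈ Y.rep t, y ∈ g x := by
  classical
  obtain ⟨H, K, hH, hK, hred⟩ := h
  refine ⟨H, K, hH, hK, fun p x hx hdom => ?_⟩
  have hex : ∀ k : Baire, (∃ a ∈ U.rep k, a ∈ f.dom) → ∃ r, ∃ a ∈ U.rep k, ∃ b ∈ V.rep r, b ∈ f a := by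
    rintro k ⟨a, ha, b, hb⟩
    obtain ⟨r, hr⟩ := V.surj b
    exact ⟨r, a, ha, b, hr, hb⟩
  -- This realizer is defined only on names of instances, so its being defined at `K p` shows that
  -- `K p` names one.
  let G : Baire →. Baire := fun k =>
    { Dom := ∃ a ∈ U.rep k, a ∈ f.dom
      get := fun h => (hex k h).choose }
  have hG : Realizes G f := by
    intro k a ha hd
    obtain ⟨a', ha', b, hb, hbf⟩ := (hex k ⟨a, ha, hd⟩).choose_spec
    rw [Part.mem_unique ha' ha] at hbf
    exact ⟨_, ⟨⟨a, ha, hd⟩, rfl⟩, b, hb, hbf⟩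
  obtain ⟨q, hq, -⟩ := hred G hG p x hx hdom
  simp only [reduct, Part.mem_bind_iff] at hq
  obtain ⟨k, hk, r₀, ⟨⟨a, ha, had⟩, -⟩, -⟩ := hq
  refine ⟨k, hk, a, ha, had, fun r b hb hbf => ?_⟩
  -- Changing a realizer at the single name `k` to any correct answer leaves a realizer.
  have hG' : Realizes (fun k' => if k' = k then Part.some r else G k') f := by
    intro k' a' ha' hd'
    by_cases hkk : k' = k
    · subst hkk
      rw [Part.mem_unique ha ha'] at hbf
      exact ⟨r, by simp, b, hb, hbf⟩
    · simpa [hkk] using hG k' a' ha' hd'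
  obtain ⟨t, ht, y, hy, hyg⟩ := hred _ hG' p x hx hdom
  simp only [reduct, Part.mem_bind_iff] at ht
  obtain ⟨k', hk', r', hr', ht⟩ := ht
  obtain rfl := Part.mem_unique hk hk'
  simp only [if_true, Part.mem_some_iff] at hr'
  subst hr'
  exact ⟨t, ht, y, hy, hyg⟩

theorem eventually_nhds_iff_pre {p : Baire} {P : Baire → Prop} :
    (∀ᶠ p' in 𝓝 p, P p') ↔ ∃ m, ∀ p', pre p' m = pre p m → P p' := by
  constructor
  · intro h
    obtain ⟨_, ⟨x, m, rfl⟩, hp, hsub⟩ :=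
      (PiNat.isTopologicalBasis_cylinders fun _ => ℕ).mem_nhds_iff.1 h
    refine ⟨m, fun p' hp' => hsub fun i hi => ?_⟩
    rw [pre_eq_pre_iff.1 hp' i hi]
    exact hp i hi
  · rintro ⟨m, hm⟩
    exact (eventually_pre_eq p m).mono hm

theorem continuous_pairing : Continuous fun z : Baire × Baire => pairing z.1 z.2 := by
  refine continuous_pi fun n => ?_
  by_cases h : n % 2 = 0
  · simp only [pairing, h, if_true]
    fun_prop
  · simp only [pairing, h, if_false]
    fun_prop

/-! ### Compactness and closed choice on metric spaces -/

section Metric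

variable {X : Type} [MetricSpace X] {α : ℕ → X} {hα : DenseRange α}

theorem mem_closedSpace_rep {p : Baire} {A : TopologicalSpace.Closeds X} :
    A ∈ (closedSpace α hα).rep p ↔ (A : Set X) = (⋃ n, basicBall α (p n))ᶜ :=
  Part.mem_some_iff.trans TopologicalSpace.Closeds.ext_iff

theorem mem_cauchySpace_rep {p : Baire} {x : X} :
    x ∈ (cauchySpace α hα).rep p ↔
      (∀ i j : ℕ, i ≤ j → dist (α (p i)) (α (p j)) ≤ (1 / 2 : ℝ) ^ i) ∧
        Tendsto (fun n => α (p n)) atTop (𝓝 x) := by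
  constructor
  · rintro ⟨h, hx⟩
    have hx : h.2.choose = x := hx
    exact ⟨h.1, hx ▸ h.2.choose_spec⟩
  · rintro ⟨h, hx⟩
    exact ⟨⟨h, x, hx⟩, tendsto_nhds_unique (X := X) (Exists.choose_spec (p := fun y : X =>
      Tendsto (fun n => α (p n)) atTop (𝓝 y)) ⟨x, hx⟩) hx⟩

theorem dist_le_one_of_mem_cauchySpace_rep {p : Baire} {x : X}
    (h : x ∈ (cauchySpace α hα).rep p) : dist x (α (p 0)) ≤ 1 := by
  obtain ⟨hd, hx⟩ := mem_cauchySpace_rep.1 h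
  refine le_of_tendsto (hx.dist tendsto_const_nhds) (Eventually.of_forall fun j => ?_)
  rw [dist_comm]
  simpa using hd 0 j (Nat.zero_le j)

/-- The points of a compact set have names in a compact set. -/
theorem exists_isCompact_names (hα : DenseRange α) {K : Set X} (hK : IsCompact K) :
    ∃ Z : Set (X × Baire), IsCompact Z ∧ (∀ z ∈ Z, z.1 ∈ (cauchySpace α hα).rep z.2) ∧
      ∀ x ∈ K, ∃ r, (x, r) ∈ Z := by
  have hF : ∀ i : ℕ, ∃ F : Finset ℕ, ∀ x ∈ K, ∃ m ∈ F, dist x (α m) < (1 / 2 : ℝ) ^ (i + 1) := by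
    intro i
    obtain ⟨F, hF⟩ := hK.elim_finite_subcover
      (fun m => Metric.ball (α m) ((1 / 2 : ℝ) ^ (i + 1))) (fun _ => Metric.isOpen_ball)
      fun x _ => Set.mem_iUnion.2 (hα.exists_dist_lt x (by positivity))
    exact ⟨F, fun x hx => by simpa using hF hx⟩
  choose F hF using hF
  -- Finitely many candidates for each digit give compactness; precision `2⁻⁽ⁱ⁺¹⁾` lets two errors
  -- add up to at most `2⁻ⁱ`.
  refine ⟨(K ×ˢ Set.univ.pi fun i => (F i : Set ℕ)) ∩
    ⋂ i, {z : X × Baire | dist z.1 (α (z.2 i)) ≤ (1 / 2 : ℝ) ^ (i + 1)}, ?_, ?_, ?_⟩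
  · refine (hK.prod (isCompact_univ_pi fun i => (F i).finite_toSet.isCompact)).inter_right
      (isClosed_iInter fun i => isClosed_le ?_ continuous_const)
    have : Continuous α := continuous_of_discreteTopology
    fun_prop
  · rintro ⟨x, r⟩ ⟨-, hz⟩
    have hz : ∀ i, dist x (α (r i)) ≤ (1 / 2 : ℝ) ^ (i + 1) := fun i => Set.mem_iInter.1 hz i
    refine mem_cauchySpace_rep.2 ⟨fun i j hij => ?_, ?_⟩
    · have h1 := dist_triangle_left (α (r i)) (α (r j)) x
      have h2 : (1 / 2 : ℝ) ^ (j + 1) ≤ (1 / 2 : ℝ) ^ (i + 1) :=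
        pow_le_pow_of_le_one (by norm_num) (by norm_num) (by omega)
      have h3 : (1 / 2 : ℝ) ^ (i + 1) = (1 / 2 : ℝ) ^ i / 2 := by ring
      linarith [hz i, hz j]
    · rw [tendsto_iff_dist_tendsto_zero]
      refine squeeze_zero (fun _ => dist_nonneg) (fun n => ?_)
        ((tendsto_pow_atTop_nhds_zero_of_lt_one (by norm_num : (0 : ℝ) ≤ 1 / 2)
          (by norm_num)).comp (tendsto_add_atTop_nat 1))
      rw [dist_comm]
      exact hz n
  · intro x hx
    choose r hrF hr using fun i => hF i x hx
    exact ⟨r, ⟨hx, fun i _ => hrF i⟩, Set.mem_iInter.2 fun i => (hr i).le⟩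

/-- Every finite word can be extended to a name, in the completion, of a closed set with bounded
complement that avoids a given ball. -/
theorem exists_extension (hα : DenseRange α) (p : Baire) (m c : ℕ) :
    ∃ p', pre p' m = pre p m ∧ ∃ B : TopologicalSpace.Closeds X,
      some B ∈ (closedSpace α hα).completion.rep p' ∧ Bornology.IsBounded (B : Set X)ᶜ ∧
        Disjoint (B : Set X) (basicBall α c) := by
  -- Repeating `c + 1` keeps infinitely many nonzero digits but removes only finitely many distinct
  -- balls.
  set p' : Baire := fun i => if i < m then p i else c + 1 with hp'
  have hinf : {n | p' n ≠ 0}.Infinite := by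
    refine (Set.Ici_infinite m).mono fun i (hi : m ≤ i) => ?_
    simp [hp', not_lt.2 hi]
  obtain ⟨q, hq⟩ : ∃ q, q ∈ decr p' := ⟨_, hinf, rfl⟩
  have hrange := exists_apply_eq_iff_of_mem_decr hq
  obtain ⟨B, hB⟩ : ∃ B : TopologicalSpace.Closeds X, B ∈ (closedSpace α hα).rep q :=
    ⟨_, Part.mem_some _⟩
  have hBq := mem_closedSpace_rep.1 hB
  refine ⟨p', pre_eq_pre_iff.2 fun i hi => by simp [hp', hi], B,
    some_mem_completion_rep.2 ⟨q, hq, hB⟩, ?_, ?_⟩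
  · have hfin : (Set.range q).Finite := by
      refine (((Finset.range m).image fun i => p i - 1) ∪ {c}).finite_toSet.subset ?_
      rintro _ ⟨n, rfl⟩
      obtain ⟨i, hi⟩ := (hrange (q n)).1 ⟨n, rfl⟩
      by_cases him : i < m
      · have : p i = q n + 1 := by simpa [hp', him] using hi
        simp only [Finset.coe_union, Finset.coe_image, Set.mem_union, Set.mem_image]
        exact Or.inl ⟨i, by simpa using him, by omega⟩
      · have : c = q n := by simpa [hp', him] using hi
        simp [this]
    rw [hBq, compl_compl, ← Set.biUnion_range (g := basicBall α)]
    exact (Bornology.isBounded_biUnion hfin).2 fun _ _ => Metric.isBounded_ball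
  · obtain ⟨n, hn⟩ := (hrange c).2 ⟨m, by simp [hp']⟩
    rw [hBq, Set.disjoint_compl_left_iff_subset, ← hn]
    exact Set.subset_iUnion (fun n => basicBall α (q n)) n

/-- The answers of a computable map that solves a fixed completed instance for all names in a
compact set are bounded, uniformly for the instances close to the given one. -/
theorem exists_forall_dist_le {H : Baire →. Baire} (hH : IsComputable H) (x₀ : X) {p : Baire}
    {Z : Set (X × Baire)} (hZ : IsCompact Z) {Q : Baire → X → Prop}
    (hQ : ∀ x, ¬ Q p x → ∀ᶠ z in 𝓝 (p, x), ¬ Q z.1 z.2)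
    (hsol : ∀ z ∈ Z, Q p z.1 →
      ∃ t ∈ H (pairing p z.2), ∃ y, some y ∈ (cauchySpace α hα).completion.rep t) :
    ∃ R : ℝ, ∀ᶠ p' in 𝓝 p, ∀ z ∈ Z, Q p' z.1 → ∀ t ∈ H (pairing p' z.2), ∀ y : X,
      some y ∈ (cauchySpace α hα).completion.rep t → dist y x₀ ≤ R := by
  classical
  refine hZ.induction_on (p := fun s => ∃ R : ℝ, ∀ᶠ p' in 𝓝 p, ∀ z ∈ s, Q p' z.1 →
    ∀ t ∈ H (pairing p' z.2), ∀ y : X,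
      some y ∈ (cauchySpace α hα).completion.rep t → dist y x₀ ≤ R) ?_ ?_ ?_ ?_
  · exact ⟨0, by simp⟩
  · rintro s t hst ⟨R, hR⟩
    exact ⟨R, hR.mono fun p' h z hz => h z (hst hz)⟩
  · rintro s t ⟨R, hR⟩ ⟨R', hR'⟩
    refine ⟨max R R', ?_⟩
    filter_upwards [hR, hR'] with p' h h' z hz hQz u hu y hy
    rcases hz with hz | hz
    · exact (h z hz hQz u hu y hy).trans (le_max_left _ _)
    · exact (h' z hz hQz u hu y hy).trans (le_max_right _ _)
  · intro z hz
    suffices h : ∃ R : ℝ, ∀ᶠ w : Baire × (X × Baire) in 𝓝 (p, z), Q w.1 w.2.1 →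
        ∀ t ∈ H (pairing w.1 w.2.2), ∀ y : X,
          some y ∈ (cauchySpace α hα).completion.rep t → dist y x₀ ≤ R by
      obtain ⟨R, hR⟩ := h
      rw [nhds_prod_eq] at hR
      obtain ⟨P₁, h₁, P₂, h₂, h⟩ := eventually_prod_iff.1 hR
      exact ⟨{z | P₂ z}, mem_nhdsWithin_of_mem_nhds h₂, R, h₁.mono fun p' hp' z' hz' => h hp' hz'⟩
    by_cases hQz : Q p z.1
    · obtain ⟨t, ht, y, hy⟩ := hsol z hz hQz
      obtain ⟨q, hq, -⟩ := some_mem_completion_rep.1 hy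
      -- The first nonzero digit of the output fixes the answer up to distance 1, and nearby inputs
      -- share it.
      have hex : ∃ j, t j ≠ 0 := (mem_decr_iff.1 hq).1.nonempty
      set j := Nat.find hex with hj
      have hcont : Tendsto (fun w : Baire × (X × Baire) => pairing w.1 w.2.2) (𝓝 (p, z))
          (𝓝 (pairing p z.2)) :=
        (continuous_pairing.comp (by fun_prop :
          Continuous fun w : Baire × (X × Baire) => (w.1, w.2.2))).tendsto (p, z)
      have hall : ∀ᶠ s in 𝓝 (pairing p z.2), ∀ i ∈ Finset.range (j + 1), ∀ t' ∈ H s, t' i = t i :=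
        (Filter.eventually_all_finset _).2 fun i _ => hH.eventually_apply_eq ht i
      refine ⟨1 + dist (α (t j - 1)) x₀, (hcont.eventually hall).mono fun w hw _ t' ht' y' hy' => ?_⟩
      obtain ⟨q', hq', hy'⟩ := some_mem_completion_rep.1 hy'
      have heq : ∀ i ≤ j, t' i = t i := fun i hi =>
        hw i (Finset.mem_range.2 (Nat.lt_succ_of_le hi)) t' ht'
      have hnth : Nat.nth (fun m => t' m ≠ 0) 0 = j := by
        have hex' : ∃ n, t' n ≠ 0 := ⟨j, by rw [heq j le_rfl]; exact Nat.find_spec hex⟩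
        rw [Nat.nth_zero_of_exists hex', Nat.find_eq_iff]
        refine ⟨by rw [heq j le_rfl]; exact Nat.find_spec hex, fun i hi => ?_⟩
        rw [heq i hi.le]
        exact Nat.find_min hex hi
      have hq0 : q' 0 = t j - 1 := by
        rw [(mem_decr_iff.1 hq').2, hnth, heq j le_rfl]
      have h1 := dist_le_one_of_mem_cauchySpace_rep (x := (y' : X)) hy'
      rw [hq0] at h1
      have h2 : dist y' x₀ ≤ dist y' (α (t j - 1)) + dist (α (t j - 1)) x₀ := dist_triangle _ _ _
      linarith
    -- Here `Q` fails throughout a neighbourhood, so any bound will do.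
    · refine ⟨0, ?_⟩
      have hcont : Tendsto (fun w : Baire × (X × Baire) => (w.1, w.2.1)) (𝓝 (p, z))
          (𝓝 (p, z.1)) :=
        (by fun_prop : Continuous fun w : Baire × (X × Baire) => (w.1, w.2.1)).tendsto (p, z)
      exact (hcont.eventually (hQ _ hQz)).mono fun w hw h => (hw h).elim

/-- The completion of a restriction of closed choice on a proper metric space is not reducible to
this restriction if its domain contains all closed sets with bounded complement. -/
theorem not_completion_reducible [ProperSpace X]
    (f : Problem (closedSpace α hα) (cauchySpace α hα))
    (hf : ∀ A : TopologicalSpace.Closeds X, A ∈ f.dom → f A = (A : Set X))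
    (hdom : ∀ A : TopologicalSpace.Closeds X, Bornology.IsBounded (A : Set X)ᶜ → A ∈ f.dom) :
    ¬ Reducible f.completion f := by
  intro hred
  obtain ⟨H, K, hH, hK, hred⟩ := hred.exists_pointwise
  have key : ∀ p, ∃ k ∈ K p, ∃ A : TopologicalSpace.Closeds X,
      A ∈ (closedSpace α hα).rep k ∧ (A : Set X).Nonempty ∧
        ∀ r, ∀ x ∈ A, x ∈ (cauchySpace α hα).rep r →
          ∃ t ∈ H (pairing p r), ∃ y ∈ (cauchySpace α hα).completion.rep t,
            ∀ B : TopologicalSpace.Closeds X, some B ∈ (closedSpace α hα).completion.rep p →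
              Bornology.IsBounded (B : Set X)ᶜ → ∃ b ∈ B, y = some b := by
    intro p
    obtain ⟨a, ha⟩ := exists_mem_completion_rep (closedSpace α hα) p
    obtain ⟨k, hk, A, hA, hAd, hsol⟩ := hred p a ha (mem_dom_completion f a)
    refine ⟨k, hk, A, hA, ?_, fun r x hx hr => ?_⟩
    · have : (f A).Nonempty := hAd
      rwa [hf A hAd] at this
    · obtain ⟨t, ht, y, hy, hyf⟩ := hsol r x hr (by rw [hf A hAd]; exact hx)
      refine ⟨t, ht, y, hy, fun B hB hBb => ?_⟩
      obtain ⟨b, hb, hyb⟩ := hyf B (Part.mem_unique ha hB) (hdom B hBb)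
      rw [hf B (hdom B hBb)] at hb
      exact ⟨b, hb, hyb⟩
  choose k hk A hA hne hsol using key
  -- A single ball listed by `k p` excludes `x`, and one digit of `K` is locally constant.
  have hopen : ∀ p x, ¬ x ∈ A p → ∀ᶠ z : Baire × X in 𝓝 (p, x), ¬ z.2 ∈ A z.1 := by
    have hmem : ∀ p x, ¬ x ∈ A p ↔ ∃ n, x ∈ basicBall α (k p n) := by
      intro p x
      rw [← SetLike.mem_coe, mem_closedSpace_rep.1 (hA p)]
      simp
    intro p x hx
    obtain ⟨n, hn⟩ := (hmem p x).1 hx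
    rw [nhds_prod_eq]
    filter_upwards [(hK.eventually_apply_eq (hk p) n).prod_mk
      ((isOpen_basicBall α (k p n)).mem_nhds hn)] with z hz
    refine (hmem _ _).2 ⟨n, ?_⟩
    rw [hz.1 _ (hk _)]
    exact hz.2
  set x₀ := α 0
  obtain ⟨n, p₀, hp₀⟩ := nonempty_interior_of_iUnion_of_closed
    (f := fun n : ℕ => {p : Baire | ∃ x ∈ Metric.closedBall x₀ (n : ℝ), x ∈ A p}) (by
      intro n
      rw [← isOpen_compl_iff, isOpen_iff_eventually]
      intro p hp
      have := (isCompact_closedBall x₀ (n : ℝ)).eventually_forall_of_forall_eventually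
        (P := fun p x => ¬ x ∈ A p) fun x hx => hopen p x fun hxA => hp ⟨x, hx, hxA⟩
      filter_upwards [this] with p' hp'
      rintro ⟨x, hx, hxA⟩
      exact hp' x hx hxA) (by
      refine Set.eq_univ_of_forall fun p => ?_
      obtain ⟨x, hx⟩ := hne p
      obtain ⟨n, hn⟩ := exists_nat_ge (dist x x₀)
      exact Set.mem_iUnion.2 ⟨n, x, hn, hx⟩)
  obtain ⟨m, hm⟩ := eventually_nhds_iff_pre.1 (mem_interior_iff_mem_nhds.1 hp₀)
  obtain ⟨Z, hZ, hZname, hZex⟩ := exists_isCompact_names hα (isCompact_closedBall x₀ (n : ℝ))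
  -- Only the bounded complement matters here; the ball code 0 is arbitrary.
  obtain ⟨p₁, hp₁, B₁, hB₁, hB₁b, -⟩ := exists_extension hα p₀ m 0
  obtain ⟨R, hR⟩ := exists_forall_dist_le (hα := hα) hH x₀ hZ (Q := fun p x => x ∈ A p) (hopen p₁)
    fun z hz hzA => by
      obtain ⟨t, ht, y, hy, hyB⟩ := hsol p₁ z.2 z.1 hzA (hZname z hz)
      obtain ⟨b, -, rfl⟩ := hyB B₁ hB₁ hB₁b
      exact ⟨t, ht, b, hy⟩
  obtain ⟨m', hm'⟩ := eventually_nhds_iff_pre.1 hR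
  obtain ⟨N, hN⟩ := exists_nat_gt R
  -- The code is the ball about `x₀` of radius `N > R`; prefix `m` keeps `A p₂` meeting the compact
  -- ball, prefix `m'` keeps the bound `R`.
  obtain ⟨p₂, hp₂, B₂, hB₂, hB₂b, hdisj⟩ :=
    exists_extension hα p₁ (max m m') (Nat.pair 0 (Nat.pair N 0))
  have hpre : ∀ i < max m m', p₂ i = p₁ i := pre_eq_pre_iff.1 hp₂
  obtain ⟨x, hx, hxA⟩ := hm p₂ (hp₁ ▸ pre_eq_pre_iff.2 fun i hi => hpre i (lt_max_of_lt_left hi))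
  obtain ⟨r, hr⟩ := hZex x hx
  obtain ⟨t, ht, y, hy, hyB⟩ := hsol p₂ r x hxA (hZname _ hr)
  obtain ⟨b, hb, rfl⟩ := hyB B₂ hB₂ hB₂b
  have hbR := hm' p₂ (pre_eq_pre_iff.2 fun i hi => hpre i (lt_max_of_lt_right hi)) _ hr hxA t ht b hy
  refine Set.disjoint_left.1 hdisj hb ?_
  simpa [basicBall] using hbR.trans_lt hN

end Metric

/-! ### The real line -/

theorem choiceReal_strictlyReducible : StrictlyReducible choiceReal choiceReal.completion := by
  refine ⟨reducible_completion _, not_completion_reducible _ (fun _ _ => rfl) fun A hA => ?_⟩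
  change (A : Set ℝ).Nonempty
  by_contra h
  rw [Set.not_nonempty_iff_eq_empty.1 h, Set.compl_empty] at hA
  exact NoncompactSpace.noncompact_univ (Metric.isCompact_of_isClosed_isBounded isClosed_univ hA)

theorem positiveChoiceReal_strictlyReducible :
    StrictlyReducible positiveChoiceReal positiveChoiceReal.completion := by
  refine ⟨reducible_completion _, not_completion_reducible _ ?_ fun A hA => ?_⟩
  · rintro A ⟨_, -, hμ⟩
    exact Set.ext fun x => ⟨fun h => h.1, fun h => ⟨h, hμ⟩⟩
  -- A null set with bounded complement would give the line finite measure.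
  · have hpos : 0 < MeasureTheory.volume (A : Set ℝ) := by
      by_contra h
      have h1 := MeasureTheory.measure_union_le (μ := MeasureTheory.volume) (A : Set ℝ) (A : Set ℝ)ᶜ
      rw [Set.union_compl_self, Real.volume_univ, nonpos_iff_eq_zero.1 (not_lt.1 h), zero_add] at h1
      exact absurd (hA.measure_lt_top (μ := MeasureTheory.volume)) (not_lt.2 h1)
    obtain ⟨x, hx⟩ := MeasureTheory.nonempty_of_measure_ne_zero hpos.ne'
    exact ⟨x, hx, hpos⟩

end Weihrauch

theorem proposition10p1 :
    Weihrauch.StrictlyReducible Weihrauch.choiceReal Weihrauch.choiceReal.completion ∧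
      Weihrauch.StrictlyReducible Weihrauch.positiveChoiceReal
        Weihrauch.positiveChoiceReal.completion :=
  ⟨Weihrauch.choiceReal_strictlyReducible, Weihrauch.positiveChoiceReal_strictlyReducible⟩
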